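/- Let $d_A,d_B\ge 1$, $d=\min\{d_A,d_B\}$, $D=\max\{d_A,d_B\}$, and assume $D\le d^3$; let $h>1$ be an integer. Let $\{A_i\}_{i=1}^{d_A^2}$ and $\{B_j\}_{j=1}^{d_B^2}$ be orthonormal bases, for the Hilbert–Schmidt inner product $\langle X,Y\rangle=\operatorname{tr}(XY)$, of the real vector spaces of Hermitian $d_A\times d_A$ and $d_B\times d_B$ matrices. For a density matrix $\rho$ on $\mathbb{C}^{d_A}\otimes\mathbb{C}^{d_B}$ let $\mathcal{C}$ be the real $d_A^2\times d_B^2$ correlation matrix $\mathcal{C}_{ij}=\operatorname{tr}(\rho\,A_i\otimes B_j)$. Let $C_h(\mathcal{C})$ be its $h$-th compound matrix, i.e. the matrix of all $h\times h$ minors $\det\mathcal{C}_{R,S}$, where $R$ and $S$ run over the $h$-element sets of row and column indices, and let $\mathcal{M}_{h,1}=\|C_h(\mathcal{C})\|_1$ be its Schatten $1$-norm, i.e. the sum of its singular values (so $\mathcal{M}_{h,1}=0$ if $h>d^2$). The state $\rho$ is separable if it is a finite convex combination of products $\rho^A_k\otimes\rho^B_k$ of density matrices, and it is in Filter Normal Form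 if $\operatorname{tr}(\rho\,X\otimes\mathbb{1})=0$ and $\operatorname{tr}(\rho\,\mathbb{1}\otimes Y)=0$ for all traceless Hermitian $X$ and $Y$. Then every separable state $\rho$ in Filter Normal Form satisfies $$\mathcal{M}_{h,1}\le S_h(\alpha,\underbrace{\beta,\ldots,\beta}_{d^2-1}),$$ where $S_h(x_1,\ldots,x_{d^2})=\sum_{R\subseteq\{1,\ldots,d^2\},\,|R|=h}\ \prod_{k\in R}x_k$ is the $h$-th elementary symmetric polynomial in $d^2$ variables, and $$\alpha=\frac{1}{\sqrt{Dd}},\qquad \beta=\sqrt{\frac{D-1}{D(d^2-1)}\cdot\frac{d-1}{d(d^2-1)}}$$ (for $d=1$ there is no variable $\beta$). -/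

import Mathlib

open scoped Kronecker ComplexOrder

noncomputable section

/-- A density matrix: positive semidefinite with unit trace. -/
def IsDensityMatrix {n : Type*} [Fintype n] (ρ : Matrix n n ℂ) : Prop :=
  ρ.PosSemidef ∧ ρ.trace = 1

/-- A bipartite state is separable if it is a finite convex combination of products
of density matrices. -/
def IsSeparableState {dA dB : ℕ} (ρ : Matrix (Fin dA × Fin dB) (Fin dA × Fin dB) ℂ) : Prop :=
  ∃ (n : ℕ) (p : Fin n → ℝ) (O : Fin n → Matrix (Fin dA) (Fin dA) ℂ)
    (Q : Fin n → Matrix (Fin dB) (Fin dB) ℂ),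
    (∀ k, 0 ≤ p k) ∧ ∑ k, p k = 1 ∧
    (∀ k, IsDensityMatrix (O k)) ∧ (∀ k, IsDensityMatrix (Q k)) ∧
    ρ = ∑ k, (p k : ℂ) • (O k ⊗ₖ Q k)

/-- The expectation value `⟨X⟩_ρ = tr (ρ X)`. -/
def expectation {n : Type*} [Fintype n] (ρ X : Matrix n n ℂ) : ℂ :=
  (ρ * X).trace

/-- Filter Normal Form: traceless local observables have vanishing expectation value. -/
def IsFilterNormalForm {dA dB : ℕ}
    (ρ : Matrix (Fin dA × Fin dB) (Fin dA × Fin dB) ℂ) : Prop :=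
  (∀ X : Matrix (Fin dA) (Fin dA) ℂ, X.IsHermitian → X.trace = 0 →
    expectation ρ (X ⊗ₖ (1 : Matrix (Fin dB) (Fin dB) ℂ)) = 0) ∧
  (∀ Y : Matrix (Fin dB) (Fin dB) ℂ, Y.IsHermitian → Y.trace = 0 →
    expectation ρ ((1 : Matrix (Fin dA) (Fin dA) ℂ) ⊗ₖ Y) = 0)

/-- An orthonormal family of `n ^ 2` Hermitian `n × n` matrices for the Hilbert-Schmidt inner
product. As the real vector space of such matrices has dimension `n ^ 2`, it is a basis of it. -/
def IsObservableBasis {n : ℕ} (A : Fin (n ^ 2) → Matrix (Fin n) (Fin n) ℂ) : Prop :=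
  (∀ i, (A i).IsHermitian) ∧ ∀ i j, (A i * A j).trace = if i = j then 1 else 0

/-- The correlation matrix `C i j = ⟨A i ⊗ B j⟩_ρ`; the expectation values are real when `ρ` and
the observables are Hermitian. -/
def correlationMatrix {dA dB : ℕ} (A : Fin (dA ^ 2) → Matrix (Fin dA) (Fin dA) ℂ)
    (B : Fin (dB ^ 2) → Matrix (Fin dB) (Fin dB) ℂ)
    (ρ : Matrix (Fin dA × Fin dB) (Fin dA × Fin dB) ℂ) :
    Matrix (Fin (dA ^ 2)) (Fin (dB ^ 2)) ℝ :=
  Matrix.of fun i j => (expectation ρ (A i ⊗ₖ B j)).re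

/-- The `h`-th compound matrix: the matrix of all `h × h` minors, with rows and columns indexed
by the `h`-element subsets of the row and column indices. -/
def compoundMatrix {m n : ℕ} (h : ℕ) (M : Matrix (Fin m) (Fin n) ℝ) :
    Matrix {R : Finset (Fin m) // R.card = h} {S : Finset (Fin n) // S.card = h} ℝ :=
  Matrix.of fun R S => (M.submatrix (R.1.orderEmbOfFin R.2) (S.1.orderEmbOfFin S.2)).det

/-- The Schatten `p`-norm of a real matrix (`1 ≤ p < ∞`): the `ℓ^p` norm of the vector of its
singular values, taken with respect to the Euclidean inner products. -/
def schattenNorm {m n : Type*} [Fintype m] [Fintype n] [DecidableEq n] (p : ℝ)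
    (M : Matrix m n ℝ) : ℝ :=
  (∑ i ∈ Finset.range (min (Fintype.card m) (Fintype.card n)),
    (Matrix.toEuclideanLin M).singularValues i ^ p) ^ (1 / p)

/-- The Correlation Minor Norm with parameters `h` and `p` of a correlation matrix. -/
def correlationMinorNorm {m n : ℕ} (h : ℕ) (p : ℝ) (C : Matrix (Fin m) (Fin n) ℝ) : ℝ :=
  schattenNorm p (compoundMatrix h C)

end

/-!
Write the separable state as `ρ = ∑ k, p k • O k ⊗ Q k` and record each local state by its coordinate
vector in the given basis of observables, so that the correlation matrix is `∑ k, p k • (a k)(b k)ᵀ`.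
Inner products of coordinate vectors are Hilbert–Schmidt inner products, because the `n ^ 2`
orthonormal observables are complete (`IsObservableBasis.inner_observableCoords`).  Filter Normal Form
says that both marginals are maximally mixed, and then the terms mixing the identity with traceless
parts cancel:
`C = α • e fᵀ + ∑ k, p k • (a' k)(b' k)ᵀ`,
where `e`, `f` are the unit vectors along the coordinates of the identities and `a' k`, `b' k` come
from the traceless parts of `O k`, `Q k`.  These are orthogonal to `e`, `f`, and as the purity of a
state is at most one, their squared norms are at most `1 - 1 / dA` and `1 - 1 / dB`.

The trace norm of a sum of rank-one matrices is at most the sum of the products of the norms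
(`schattenNorm_one_le_of_eq_sum`), so the second summand of `C` has trace norm at most
`√((1 - 1 / dA) (1 - 1 / dB)) = (d ^ 2 - 1) * β`.  By orthogonality its singular vectors extend `e` and
`f` to orthonormal families, so it has at most `d ^ 2 - 1` nonzero singular values, and together with
`α` these are the singular values of `C`.

By the Cauchy–Binet formula, the compound of `∑ k, s k • (p k)(q k)ᵀ` with orthonormal `p`, `q` is a sum
over `h`-subsets `T` of rank-one matrices of norm `∏ k ∈ T, s k`; its trace norm is therefore at most
the elementary symmetric polynomial of the `s k` (`correlationMinorNorm_one_le_esymm`).  Splitting off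
the variable `α`, Maclaurin's inequality replaces the other singular values by their mean, which is at
most `β` (`Multiset.esymm_le_esymm_replicate`).
-/

/-! ### The Cauchy–Binet formula -/

/-- The **Cauchy–Binet formula**.  Multilinearity in the rows expands `det (A * B)` over all maps
`g : Fin h → Fin N`; the injective ones are the pairs of an `h`-subset and a permutation. -/
theorem det_mul_eq_sum_minors {N h : ℕ} (A : Matrix (Fin h) (Fin N) ℝ)
    (B : Matrix (Fin N) (Fin h) ℝ) :
    (A * B).det = ∑ T : {T : Finset (Fin N) // T.card = h},
      (A.submatrix id (T.1.orderEmbOfFin T.2)).det *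
        (B.submatrix (T.1.orderEmbOfFin T.2) id).det := by
  classical
  have expand : (A * B).det =
      ∑ g : Fin h → Fin N, (∏ i, A i (g i)) * (B.submatrix g id).det := by
    have hrow : (A * B) = fun i => ∑ k, A i k • B k := by
      ext i j
      simp [Matrix.mul_apply]
    change Matrix.detRowAlternating.toMultilinearMap (A * B) = _
    rw [hrow]
    rw [MultilinearMap.map_sum]
    refine Finset.sum_congr rfl fun g _ => ?_
    rw [MultilinearMap.map_smul_univ]
    rfl
  have vanish : ∀ g : Fin h → Fin N, ¬ Function.Injective g → (B.submatrix g id).det = 0 := by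
    intro g hg
    simp only [Function.Injective, not_forall] at hg
    obtain ⟨i, j, hij, hne⟩ := hg
    exact Matrix.det_zero_of_row_eq hne (by ext k; simp [hij])
  have key : ∑ g : Fin h → Fin N, (∏ i, A i (g i)) * (B.submatrix g id).det =
      ∑ x : {T : Finset (Fin N) // T.card = h} × Equiv.Perm (Fin h),
        (∏ i, A i (x.1.1.orderEmbOfFin x.1.2 (x.2 i))) *
          (B.submatrix (fun i => x.1.1.orderEmbOfFin x.1.2 (x.2 i)) id).det := by
    symm
    refine Finset.sum_of_injOn
      (fun x i => x.1.1.orderEmbOfFin x.1.2 (x.2 i)) ?_ (by simp) ?_ (fun _ _ => rfl)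
    · rintro ⟨T, σ⟩ - ⟨T', σ'⟩ - hx
      have hT : T = T' := by
        have := congrArg Set.range hx
        simp only [← Function.comp_def, EquivLike.range_comp, Finset.range_orderEmbOfFin] at this
        exact Subtype.ext (by exact_mod_cast this)
      subst hT
      have : σ = σ' := by
        ext i
        have := congrFun hx i
        simp only [EmbeddingLike.apply_eq_iff_eq] at this
        rw [this]
      rw [this]
    · intro g _ hg
      have hni : ¬ Function.Injective g := by
        intro hinj
        apply hg
        have hc : (Finset.univ.image g).card = h := by
          rw [Finset.card_image_of_injective _ hinj, Finset.card_fin]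
        have hmem : ∀ i, g i ∈ Set.range ((Finset.univ.image g).orderEmbOfFin hc) := by
          intro i
          rw [Finset.range_orderEmbOfFin]
          simp
        choose s hs using hmem
        have hsinj : Function.Injective s := by
          intro i j hij
          apply hinj
          rw [← hs i, ← hs j, hij]
        refine ⟨(⟨_, hc⟩, Equiv.ofBijective s (Finite.injective_iff_bijective.1 hsinj)), by simp, ?_⟩
        funext i
        simpa using hs i
      rw [vanish g hni, mul_zero]
  rw [expand, key, Fintype.sum_prod_type]
  refine Finset.sum_congr rfl fun T _ => ?_
  rw [← Matrix.det_transpose (A.submatrix _ _), Matrix.det_apply', Finset.sum_mul]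
  refine Finset.sum_congr rfl fun σ _ => ?_
  have hσ : (B.submatrix (fun i => T.1.orderEmbOfFin T.2 (σ i)) id).det =
      Equiv.Perm.sign σ * (B.submatrix (T.1.orderEmbOfFin T.2) id).det :=
    Matrix.det_permute σ (B.submatrix (T.1.orderEmbOfFin T.2) id)
  simp only [hσ, Matrix.transpose_apply, Matrix.submatrix_apply, id]
  ring

/-! ### Elementary symmetric polynomials and Maclaurin's inequality -/

theorem Multiset.esymm_cons_succ {R : Type*} [CommSemiring R] (a : R) (s : Multiset R) (k : ℕ) :
    (a ::ₘ s).esymm (k + 1) = s.esymm (k + 1) + a * s.esymm k := by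
  simp [Multiset.esymm, Multiset.powersetCard_cons, Multiset.sum_map_mul_left]

theorem Multiset.esymm_replicate {R : Type*} [CommSemiring R] (n k : ℕ) (x : R) :
    (Multiset.replicate n x).esymm k = n.choose k * x ^ k := by
  induction n generalizing k with
  | zero => cases k <;> simp [Multiset.esymm, Multiset.powersetCard_zero_right]
  | succ n ih =>
    cases k with
    | zero => simp [Multiset.esymm]
    | succ k =>
      rw [Multiset.replicate_succ, Multiset.esymm_cons_succ, ih, ih, Nat.choose_succ_succ]
      push_cast
      ring

/-- Convexity of `x ↦ x ^ (k + 1)` on the nonnegative half-line: the tangent at `m` lies below. -/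
theorem tangent_le_pow {m M : ℝ} (hm : 0 ≤ m) (hM : 0 ≤ M) (k : ℕ) :
    (k + 1) * M * m ^ k ≤ M ^ (k + 1) + k * m ^ (k + 1) := by
  induction k with
  | zero => simp
  | succ k ih =>
    have h1 : 0 ≤ (M - m) * (M ^ (k + 1) - m ^ (k + 1)) := by
      rcases le_total m M with h | h
      · exact mul_nonneg (sub_nonneg.2 h) (sub_nonneg.2 (pow_le_pow_left₀ hm h _))
      · exact mul_nonneg_of_nonpos_of_nonpos (sub_nonpos.2 h)
          (sub_nonpos.2 (pow_le_pow_left₀ hM h _))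
    have h2 := mul_le_mul_of_nonneg_left ih hm
    push_cast
    simp only [pow_succ] at *
    nlinarith

/-- **Maclaurin's inequality**, for nonnegative numbers with mean `m`.  Removing one element `y` from
`n + 1` of them leaves a multiset of mean `m'` with `y = (n + 1) * m - n * m'`, and the induction step
becomes the tangent inequality `tangent_le_pow` at `m'`. -/
theorem Multiset.esymm_le_of_sum_eq {s : Multiset ℝ} (hs : ∀ x ∈ s, 0 ≤ x) {m : ℝ} (hm : 0 ≤ m)
    (hsum : s.sum = s.card * m) (k : ℕ) : s.esymm k ≤ s.card.choose k * m ^ k := by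
  induction s using Multiset.induction_on generalizing m k with
  | empty => cases k <;> simp [Multiset.esymm, Multiset.powersetCard_zero_right]
  | cons y s ih =>
    cases k with
    | zero => simp [Multiset.esymm]
    | succ k =>
      have hy : 0 ≤ y := hs y (by simp)
      have hs' : ∀ x ∈ s, 0 ≤ x := fun x hx => hs x (Multiset.mem_cons_of_mem hx)
      obtain ⟨m', hm', hsum'⟩ : ∃ m' : ℝ, 0 ≤ m' ∧ s.sum = s.card * m' := by
        rcases Nat.eq_zero_or_pos s.card with h0 | h0
        · exact ⟨0, le_rfl, by simp [Multiset.card_eq_zero.1 h0]⟩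
        · have : (0 : ℝ) < s.card := by exact_mod_cast h0
          exact ⟨s.sum / s.card, div_nonneg (Multiset.sum_nonneg hs') this.le, by field_simp⟩
      rw [Multiset.esymm_cons_succ]
      have h1 := ih hs' hm' hsum' (k + 1)
      have h2 := mul_le_mul_of_nonneg_left (ih hs' hm' hsum' k) hy
      rw [Multiset.sum_cons, hsum', Multiset.card_cons] at hsum
      rw [Multiset.card_cons]
      set n := s.card
      push_cast at hsum
      have hyeq : y = (n + 1) * m - n * m' := by linarith
      refine (add_le_add h1 h2).trans ?_
      rw [hyeq]
      have t := tangent_le_pow hm' hm k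
      have c1 : ((n + 1).choose (k + 1) : ℝ) = n.choose k + n.choose (k + 1) := by
        rw [Nat.choose_succ_succ]; push_cast; ring
      have c2 : ((n : ℝ) + 1) * n.choose k = (n + 1).choose (k + 1) * (k + 1) := by
        exact_mod_cast Nat.add_one_mul_choose_eq n k
      have c := mul_le_mul_of_nonneg_left t (Nat.cast_nonneg (α := ℝ) ((n + 1).choose (k + 1)))
      have e1 : (n.choose (k + 1) : ℝ) = (n + 1).choose (k + 1) - n.choose k := by linarith
      rw [e1]
      have e2 : ((n + 1).choose (k + 1) : ℝ) * ((k + 1) * m * m' ^ k)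
        = ((n : ℝ) + 1) * n.choose k * m * m' ^ k := by rw [c2]; ring
      have e3 : ((n + 1).choose (k + 1) : ℝ) * (k * m' ^ (k + 1))
        = (((n : ℝ) + 1) * n.choose k - (n + 1).choose (k + 1)) * m' ^ (k + 1) := by rw [c2]; ring
      rw [e2, mul_add, e3] at c
      simp only [pow_succ] at *
      linarith

/-- Maclaurin's inequality as a comparison with a constant multiset, which may be larger: padding
with zeros does not change the elementary symmetric polynomials. -/
theorem Multiset.esymm_le_esymm_replicate {s : Multiset ℝ} (hs : ∀ x ∈ s, 0 ≤ x) {n : ℕ} {b : ℝ}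
    (hcard : s.card ≤ n) (hsum : s.sum ≤ n * b) (k : ℕ) :
    s.esymm k ≤ (Multiset.replicate n b).esymm k := by
  rcases Nat.eq_zero_or_pos n with rfl | hn
  · rw [Nat.le_zero, Multiset.card_eq_zero] at hcard
    simp [hcard]
  set t := s + Multiset.replicate (n - s.card) 0 with ht
  have htc : t.card = n := by simp [ht]; omega
  have hn' : (0 : ℝ) < n := by exact_mod_cast hn
  have hts : t.sum = t.card * (s.sum / n) := by
    rw [htc, mul_div_cancel₀ _ hn'.ne', ht]; simp
  have ht0 : ∀ x ∈ t, 0 ≤ x := by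
    intro x hx
    rcases Multiset.mem_add.1 hx with hx | hx
    · exact hs x hx
    · exact (Multiset.eq_of_mem_replicate hx).ge
  have hm : 0 ≤ s.sum / n := div_nonneg (Multiset.sum_nonneg hs) hn'.le
  have hst : ∀ j, (s + Multiset.replicate j 0).esymm k = s.esymm k := by
    intro j
    induction j with
    | zero => simp
    | succ j ih =>
      rw [Multiset.replicate_succ, Multiset.add_cons, ← ih]
      cases k with
      | zero => simp [Multiset.esymm]
      | succ k => simp [Multiset.esymm_cons_succ]
  rw [← hst (n - s.card)]
  refine (Multiset.esymm_le_of_sum_eq ht0 hm hts k).trans ?_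
  rw [htc, Multiset.esymm_replicate]
  gcongr
  rw [div_le_iff₀ hn']
  linarith

/-! ### Singular values and the trace norm -/

/-- **Singular value decomposition** of a real linear map, restricted to its nonzero
singular values. -/
theorem exists_orthonormal_singularValues {E F : Type*}
    [NormedAddCommGroup E] [InnerProductSpace ℝ E] [FiniteDimensional ℝ E]
    [NormedAddCommGroup F] [InnerProductSpace ℝ F] [FiniteDimensional ℝ F] (T : E →ₗ[ℝ] F) :
    ∃ (u : Fin (Module.finrank ℝ T.range) → F) (v : Fin (Module.finrank ℝ T.range) → E),
      Orthonormal ℝ u ∧ Orthonormal ℝ v ∧ (∀ i : Fin _, T (v i) = T.singularValues i • u i) ∧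
      ∀ x, T x = ∑ i : Fin _, (T.singularValues i * inner ℝ (v i) x) • u i := by
  set r := Module.finrank ℝ T.range
  have hr : r ≤ Module.finrank ℝ E := LinearMap.finrank_range_le T
  set hS := T.isSymmetric_adjoint_comp_self
  set w := hS.eigenvectorBasis rfl
  have hw : ∀ i j, inner ℝ (T (w i)) (T (w j)) =
      if i = j then T.singularValues i ^ 2 else 0 := by
    intro i j
    rw [← LinearMap.adjoint_inner_right, ← LinearMap.comp_apply,
      hS.apply_eigenvectorBasis rfl j, ← T.sq_singularValues_fin rfl j, inner_smul_right,
      orthonormal_iff_ite.1 w.orthonormal i j]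
    split_ifs with h <;> simp [h]
  have hpos : ∀ i : Fin r, 0 < T.singularValues i := fun i =>
    T.singularValues_pos_iff_lt_finrank_range.2 i.2
  have hTv : ∀ i : Fin r, T (w (Fin.castLE hr i)) =
      T.singularValues i • ((T.singularValues i)⁻¹ • T (w (Fin.castLE hr i))) := by
    intro i
    rw [smul_smul, mul_inv_cancel₀ (hpos i).ne', one_smul]
  refine ⟨fun i => (T.singularValues i)⁻¹ • T (w (Fin.castLE hr i)),
    fun i => w (Fin.castLE hr i), ?_, w.orthonormal.comp _ (Fin.castLE_injective hr), hTv, ?_⟩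
  · rw [orthonormal_iff_ite]
    intro i j
    rw [inner_smul_left, inner_smul_right, hw]
    by_cases h : i = j
    · subst h
      have := (hpos i).ne'
      simp
      field_simp
    · simp [h]
  · intro x
    have hx : T x = ∑ i, inner ℝ (w i) x • T (w i) := by
      conv_lhs => rw [← w.sum_repr' x, map_sum]
      simp
    rw [hx]
    symm
    refine Finset.sum_of_injOn (Fin.castLE hr) (Fin.castLE_injective hr).injOn (by simp) ?_ ?_
    · intro i _ hi
      have hi' : r ≤ i := by
        by_contra hlt
        exact hi ⟨⟨i, not_le.1 hlt⟩, by simp, rfl⟩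
      have h0 : T (w i) = 0 := by
        rw [← inner_self_eq_zero (𝕜 := ℝ), hw, if_pos rfl,
          T.singularValues_eq_zero_iff_le_finrank_range.2 hi', zero_pow two_ne_zero]
      rw [h0, smul_zero]
    · intro i _
      have := (hpos i).ne'
      rw [smul_smul]
      congr 1
      field_simp

/-- The singular values beyond the rank vanish, so the sum defining the norm stops there. -/
theorem schattenNorm_one_eq_sum {m n : Type*} [Fintype m] [Fintype n] [DecidableEq n]
    (X : Matrix m n ℝ) : schattenNorm 1 X =
      ∑ i : Fin (Module.finrank ℝ (Matrix.toEuclideanLin X).range),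
        (Matrix.toEuclideanLin X).singularValues i := by
  set T := Matrix.toEuclideanLin X
  have hr : Module.finrank ℝ T.range ≤ min (Fintype.card m) (Fintype.card n) := by
    refine le_min ?_ ?_
    · simpa using Submodule.finrank_le T.range
    · simpa using LinearMap.finrank_range_le T
  simp only [schattenNorm, Real.rpow_one, div_one]
  rw [Fin.sum_univ_eq_sum_range (fun i => T.singularValues i)]
  symm
  refine Finset.sum_subset (Finset.range_mono hr) fun i _ hi => ?_
  exact T.singularValues_eq_zero_iff_le_finrank_range.2 (by simpa using hi)

theorem inner_toEuclideanLin_of_eq_sum {m n ι : Type*} [Fintype m] [Fintype n] [DecidableEq n]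
    [Fintype ι] {X : Matrix m n ℝ} {a : ι → EuclideanSpace ℝ m} {b : ι → EuclideanSpace ℝ n}
    (hX : ∀ i j, X i j = ∑ k, a k i * b k j) (x : EuclideanSpace ℝ m) (y : EuclideanSpace ℝ n) :
    inner ℝ x (Matrix.toEuclideanLin X y) = ∑ k, inner ℝ x (a k) * inner ℝ (b k) y := by
  have hy : Matrix.toEuclideanLin X y = ∑ k, inner ℝ (b k) y • a k := by
    ext i
    simp only [Matrix.toLpLin_apply, Matrix.mulVec, dotProduct, hX, WithLp.ofLp_sum,
      Finset.sum_apply, WithLp.ofLp_smul, Pi.smul_apply, smul_eq_mul, PiLp.inner_apply,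
      RCLike.inner_apply, conj_trivial, Finset.sum_mul]
    rw [Finset.sum_comm]
    exact Finset.sum_congr rfl fun _ _ => Finset.sum_congr rfl fun _ _ => by ring
  rw [hy, inner_sum]
  exact Finset.sum_congr rfl fun k _ => by rw [inner_smul_right, mul_comm]

theorem Orthonormal.sqrt_sum_inner_sq_le {ι G : Type*} [Fintype ι] [NormedAddCommGroup G]
    [InnerProductSpace ℝ G] {w : ι → G} (hw : Orthonormal ℝ w) (x : G) :
    √(∑ i, inner ℝ (w i) x ^ 2) ≤ ‖x‖ :=
  Real.sqrt_le_iff.2 ⟨norm_nonneg _, by simpa using hw.sum_inner_products_le (s := Finset.univ) x⟩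

/-- The trace norm of a sum of rank-one matrices is at most the sum of their trace norms.  With the
singular vectors `u`, `v` of the sum, the trace norm is `∑ i, ⟪u i, X v i⟫`, to which each rank-one
term contributes at most the product of the norms, by Cauchy–Schwarz and Bessel. -/
theorem schattenNorm_one_le_of_eq_sum {m n ι : Type*} [Fintype m] [Fintype n] [DecidableEq n]
    [Fintype ι] {X : Matrix m n ℝ} {a : ι → EuclideanSpace ℝ m} {b : ι → EuclideanSpace ℝ n}
    (hX : ∀ i j, X i j = ∑ k, a k i * b k j) :
    schattenNorm 1 X ≤ ∑ k, ‖a k‖ * ‖b k‖ := by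
  obtain ⟨u, v, hu, hv, hTv, -⟩ := exists_orthonormal_singularValues (Matrix.toEuclideanLin X)
  have hs : ∀ i : Fin _, (Matrix.toEuclideanLin X).singularValues i =
      ∑ k, inner ℝ (u i) (a k) * inner ℝ (b k) (v i) := by
    intro i
    rw [← inner_toEuclideanLin_of_eq_sum hX, hTv, inner_smul_right,
      real_inner_self_eq_norm_sq, hu.1 i]
    simp
  rw [schattenNorm_one_eq_sum, Finset.sum_congr rfl fun i _ => hs i, Finset.sum_comm]
  refine Finset.sum_le_sum fun k _ => ?_
  refine (Real.sum_mul_le_sqrt_mul_sqrt _ _ _).trans ?_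
  refine mul_le_mul ?_ ?_ (Real.sqrt_nonneg _) (norm_nonneg _)
  · exact hu.sqrt_sum_inner_sq_le _
  · simp only [fun i => real_inner_comm (v i) (b k)]
    exact hv.sqrt_sum_inner_sq_le _

/-! ### The trace norm of a compound matrix -/

/-- The minors of `h` columns taken from an orthonormal family form a unit vector: by Cauchy–Binet
the sum of their squares is the Gram determinant. -/
theorem norm_minors_of_orthonormal {m N h : ℕ} {p : Fin N → EuclideanSpace ℝ (Fin m)}
    (hp : Orthonormal ℝ p) (T : {T : Finset (Fin N) // T.card = h}) :
    ‖(WithLp.toLp 2 fun R : {R : Finset (Fin m) // R.card = h} =>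
      (Matrix.of fun i k => p (T.1.orderEmbOfFin T.2 k) (R.1.orderEmbOfFin R.2 i)).det :
        EuclideanSpace ℝ {R : Finset (Fin m) // R.card = h})‖ = 1 := by
  set P : Matrix (Fin m) (Fin h) ℝ := Matrix.of fun i k => p (T.1.orderEmbOfFin T.2 k) i
  have hgram : P.transpose * P = 1 := by
    ext i j
    have h1 := orthonormal_iff_ite.1 hp (T.1.orderEmbOfFin T.2 i) (T.1.orderEmbOfFin T.2 j)
    simp only [PiLp.inner_apply, RCLike.inner_apply, conj_trivial,
      EmbeddingLike.apply_eq_iff_eq] at h1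
    rw [Matrix.one_apply, ← h1, Matrix.mul_apply]
    exact Finset.sum_congr rfl fun _ _ => mul_comm _ _
  have hcb := det_mul_eq_sum_minors P.transpose P
  rw [hgram, Matrix.det_one] at hcb
  rw [EuclideanSpace.norm_eq, Real.sqrt_eq_one, hcb]
  refine Finset.sum_congr rfl fun R _ => ?_
  rw [Real.norm_eq_abs, sq_abs, sq, ← Matrix.det_transpose (P.transpose.submatrix _ _)]
  rfl

/-- The trace norm of the `h`-th compound of `∑ k, s k • (p k)(q k)ᵀ` is at most the `h`-th elementary
symmetric polynomial of the weights `s`, for orthonormal families `p`, `q`. -/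
theorem correlationMinorNorm_one_le_esymm {m n N : ℕ} (h : ℕ) {M : Matrix (Fin m) (Fin n) ℝ}
    {s : Fin N → ℝ} (hs : ∀ k, 0 ≤ s k) {p : Fin N → EuclideanSpace ℝ (Fin m)}
    {q : Fin N → EuclideanSpace ℝ (Fin n)} (hp : Orthonormal ℝ p) (hq : Orthonormal ℝ q)
    (hM : ∀ i j, M i j = ∑ k, s k * p k i * q k j) :
    correlationMinorNorm h 1 M ≤ (Finset.univ.val.map s).esymm h := by
  set a : {T : Finset (Fin N) // T.card = h} →
      EuclideanSpace ℝ {R : Finset (Fin m) // R.card = h} := fun T =>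
    (∏ k ∈ T.1, s k) • WithLp.toLp 2 fun R =>
      (Matrix.of fun i k => p (T.1.orderEmbOfFin T.2 k) (R.1.orderEmbOfFin R.2 i)).det with ha
  set b : {T : Finset (Fin N) // T.card = h} →
      EuclideanSpace ℝ {R : Finset (Fin n) // R.card = h} := fun T => WithLp.toLp 2 fun R =>
      (Matrix.of fun i k => q (T.1.orderEmbOfFin T.2 k) (R.1.orderEmbOfFin R.2 i)).det with hb
  have hC : ∀ R S, compoundMatrix h M R S = ∑ T, a T R * b T S := by
    intro R S
    set P : Matrix (Fin h) (Fin N) ℝ := Matrix.of fun i k => s k * p k (R.1.orderEmbOfFin R.2 i)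
    set Q : Matrix (Fin N) (Fin h) ℝ := Matrix.of fun k j => q k (S.1.orderEmbOfFin S.2 j)
    have hPQ : M.submatrix (R.1.orderEmbOfFin R.2) (S.1.orderEmbOfFin S.2) = P * Q := by
      ext i j
      simp [P, Q, Matrix.mul_apply, hM]
    change (M.submatrix _ _).det = _
    rw [hPQ, det_mul_eq_sum_minors]
    refine Finset.sum_congr rfl fun T _ => ?_
    congr 1
    · have : P.submatrix id (T.1.orderEmbOfFin T.2) = Matrix.of fun i k =>
          s (T.1.orderEmbOfFin T.2 k) * (Matrix.of fun i k =>
            p (T.1.orderEmbOfFin T.2 k) (R.1.orderEmbOfFin R.2 i)) i k := rfl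
      rw [this, Matrix.det_mul_row]
      have hprod : ∏ k, s (T.1.orderEmbOfFin T.2 k) = ∏ k ∈ T.1, s k := by
        have hT := Finset.prod_map Finset.univ (T.1.orderEmbOfFin T.2).toEmbedding s
        rw [Finset.map_orderEmbOfFin_univ] at hT
        exact hT.symm
      rw [hprod]
      rfl
    · rw [← Matrix.det_transpose]
      rfl
  refine (schattenNorm_one_le_of_eq_sum hC).trans_eq ?_
  have hT : ∀ T, ‖a T‖ * ‖b T‖ = ∏ k ∈ T.1, s k := by
    intro T
    rw [ha, hb, norm_smul, norm_minors_of_orthonormal hp, norm_minors_of_orthonormal hq,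
      Real.norm_of_nonneg (Finset.prod_nonneg fun k _ => hs k)]
    ring
  rw [Finset.sum_congr rfl fun T _ => hT T, Finset.esymm_map_val]
  symm
  exact Finset.sum_subtype _ (by simp [Finset.mem_powersetCard]) _

/-- A matrix that splits as `α • e fᵀ` plus rank-one terms orthogonal to the unit vectors `e` and
`f` has at most `n` nonzero singular values besides `α`, and their sum is bounded by that of the
rank-one terms; Maclaurin's inequality then bounds the trace norm of the compound. -/
theorem correlationMinorNorm_one_le_of_orthogonal {M N n : ℕ} {ι : Type*} [Fintype ι] (h : ℕ)
    {C : Matrix (Fin M) (Fin N) ℝ} {α β : ℝ} (hα : 0 ≤ α) (hn : min M N ≤ n + 1)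
    {e : EuclideanSpace ℝ (Fin M)} {f : EuclideanSpace ℝ (Fin N)} (he : ‖e‖ = 1) (hf : ‖f‖ = 1)
    {a : ι → EuclideanSpace ℝ (Fin M)} {b : ι → EuclideanSpace ℝ (Fin N)}
    (hea : ∀ k, inner ℝ e (a k) = 0) (hfb : ∀ k, inner ℝ f (b k) = 0)
    (hC : ∀ i j, C i j = α * e i * f j + ∑ k, a k i * b k j)
    (hab : ∑ k, ‖a k‖ * ‖b k‖ ≤ n * β) :
    correlationMinorNorm h 1 C ≤ (α ::ₘ Multiset.replicate n β).esymm h := by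
  set X : Matrix (Fin M) (Fin N) ℝ := Matrix.of fun i j => ∑ k, a k i * b k j
  have hX : ∀ i j, X i j = ∑ k, a k i * b k j := fun _ _ => rfl
  have hXsum := (schattenNorm_one_le_of_eq_sum hX).trans hab
  rw [schattenNorm_one_eq_sum] at hXsum
  set T := Matrix.toEuclideanLin X with hTdef
  set r := Module.finrank ℝ T.range
  obtain ⟨u, v, hu, hv, hTv, hT⟩ := exists_orthonormal_singularValues T
  have hpos : ∀ i : Fin r, T.singularValues i ≠ 0 := fun i =>
    (T.singularValues_pos_iff_lt_finrank_range.2 i.2).ne'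
  -- `e` is orthogonal to the range of `X` and `f` lies in its kernel.
  have heu : ∀ i, inner ℝ e (u i) = 0 := by
    intro i
    have h1 := inner_toEuclideanLin_of_eq_sum hX e (v i)
    rw [← hTdef, hTv, inner_smul_right] at h1
    simp only [hea, zero_mul, Finset.sum_const_zero] at h1
    exact (mul_eq_zero.1 h1).resolve_left (hpos i)
  have hfv : ∀ i, inner ℝ f (v i) = 0 := by
    intro i
    have h1 := inner_toEuclideanLin_of_eq_sum hX (u i) f
    simp only [fun k => real_inner_comm f (b k), hfb, mul_zero, Finset.sum_const_zero] at h1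
    rw [← hTdef, hT, inner_sum] at h1
    simp only [inner_smul_right, orthonormal_iff_ite.1 hu, mul_ite, mul_one, mul_zero,
      Finset.sum_ite_eq, Finset.mem_univ, if_true] at h1
    rw [real_inner_comm]
    exact (mul_eq_zero.1 h1).resolve_left (hpos i)
  have hp : Orthonormal ℝ (Matrix.vecCons e u) := orthonormal_vecCons_iff.2 ⟨he, heu, hu⟩
  have hq : Orthonormal ℝ (Matrix.vecCons f v) := orthonormal_vecCons_iff.2 ⟨hf, hfv, hv⟩
  have hrn : r ≤ n := by
    have h1 := hp.linearIndependent.fintype_card_le_finrank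
    have h2 := hq.linearIndependent.fintype_card_le_finrank
    simp only [Fintype.card_fin, finrank_euclideanSpace] at h1 h2
    omega
  have hXentry : ∀ i j, X i j = ∑ k : Fin r, T.singularValues k * u k i * v k j := by
    intro i j
    have h1 := congrArg (fun x : EuclideanSpace ℝ (Fin M) => x i)
      (hT (EuclideanSpace.single j 1))
    simp only [hTdef, Matrix.toLpLin_apply, PiLp.ofLp_single, Matrix.mulVec_single_one,
      Matrix.col_apply, WithLp.ofLp_sum, Finset.sum_apply, WithLp.ofLp_smul, Pi.smul_apply,
      smul_eq_mul, EuclideanSpace.inner_single_right, conj_trivial, one_mul] at h1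
    rw [h1]
    exact Finset.sum_congr rfl fun _ _ => by ring
  have hdec : ∀ i j, C i j = ∑ k, (Matrix.vecCons α fun k : Fin r => T.singularValues k) k *
      Matrix.vecCons e u k i * Matrix.vecCons f v k j := by
    intro i j
    rw [hC, ← hX, hXentry, Fin.sum_univ_succ]
    rfl
  refine (correlationMinorNorm_one_le_esymm h ?_ hp hq hdec).trans ?_
  · intro k
    refine Fin.cases hα (fun k => T.singularValues_nonneg k) k
  have hmap : Finset.univ.val.map (Matrix.vecCons α fun k : Fin r => T.singularValues k) =
      α ::ₘ Finset.univ.val.map fun k : Fin r => T.singularValues k := by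
    rw [Fin.univ_succ, Finset.cons_val, Multiset.map_cons, Finset.map_val, Multiset.map_map]
    rfl
  have hmac : ∀ k, (Finset.univ.val.map fun k : Fin r => T.singularValues k).esymm k ≤
      (Multiset.replicate n β).esymm k := by
    refine Multiset.esymm_le_esymm_replicate ?_ (by simpa using hrn) hXsum
    intro x hx
    obtain ⟨k, -, rfl⟩ := Multiset.mem_map.1 hx
    exact T.singularValues_nonneg k
  rw [hmap]
  cases h with
  | zero => simp [Multiset.esymm]
  | succ h =>
    rw [Multiset.esymm_cons_succ, Multiset.esymm_cons_succ]
    exact add_le_add (hmac _) (mul_le_mul_of_nonneg_left (hmac _) hα)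

/-! ### Coordinates in a basis of observables -/

/-- The coordinates of a Hermitian matrix in an orthonormal basis of observables; only the real
parts of the (real) expectation values are recorded. -/
noncomputable def observableCoords {n : ℕ} (A : Fin (n ^ 2) → Matrix (Fin n) (Fin n) ℂ)
    (X : Matrix (Fin n) (Fin n) ℂ) : EuclideanSpace ℝ (Fin (n ^ 2)) :=
  WithLp.toLp 2 fun i => (expectation X (A i)).re

theorem expectation_eq_ofReal_re {n : Type*} [Fintype n] {X Y : Matrix n n ℂ}
    (hX : X.IsHermitian) (hY : Y.IsHermitian) :
    expectation X Y = ((expectation X Y).re : ℂ) := by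
  symm
  rw [← Complex.conj_eq_iff_re]
  unfold expectation
  change star _ = _
  rw [← Matrix.trace_conjTranspose, Matrix.conjTranspose_mul, hX.eq, hY.eq, Matrix.trace_mul_comm]

theorem isHermitian_sub_smul_one {n : ℕ} {O : Matrix (Fin n) (Fin n) ℂ} (hO : O.IsHermitian)
    (c : ℝ) : (O - (c : ℂ) • (1 : Matrix (Fin n) (Fin n) ℂ)).IsHermitian :=
  hO.sub (by rw [Matrix.IsHermitian, Matrix.conjTranspose_smul, Matrix.conjTranspose_one,
        Complex.star_def, Complex.conj_ofReal])

/-- Completeness: `n ^ 2` orthonormal observables span all complex `n × n` matrices. -/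
theorem IsObservableBasis.sum_trace_smul {n : ℕ} {A : Fin (n ^ 2) → Matrix (Fin n) (Fin n) ℂ}
    (hA : IsObservableBasis A) (X : Matrix (Fin n) (Fin n) ℂ) :
    ∑ i, (A i * X).trace • A i = X := by
  have hli : LinearIndependent ℂ A := by
    rw [Fintype.linearIndependent_iff]
    intro g hg i
    have h1 := congrArg (fun Y => (A i * Y).trace) hg
    simpa [Matrix.mul_sum, Matrix.trace_sum, hA.2] using h1
  have hspan := hli.span_eq_top_of_card_eq_finrank' (by simp [Module.finrank_matrix, sq])
  have hX : X ∈ Submodule.span ℂ (Set.range A) := hspan ▸ Submodule.mem_top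
  obtain ⟨c, rfl⟩ := (Submodule.mem_span_range_iff_exists_fun ℂ).1 hX
  refine Finset.sum_congr rfl fun i _ => ?_
  simp [Matrix.mul_sum, Matrix.trace_sum, hA.2]

theorem IsObservableBasis.inner_observableCoords {n : ℕ}
    {A : Fin (n ^ 2) → Matrix (Fin n) (Fin n) ℂ} (hA : IsObservableBasis A)
    {X Y : Matrix (Fin n) (Fin n) ℂ} (hX : X.IsHermitian) (hY : Y.IsHermitian) :
    inner ℝ (observableCoords A X) (observableCoords A Y) = (X * Y).trace.re := by
  have h1 : (X * Y).trace = ∑ i, expectation Y (A i) * expectation X (A i) := by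
    conv_lhs => rw [← hA.sum_trace_smul Y]
    simp [Matrix.mul_sum, Matrix.trace_sum, expectation, Matrix.trace_mul_comm Y]
  rw [h1, Complex.re_sum]
  simp only [observableCoords, PiLp.inner_apply, RCLike.inner_apply, conj_trivial]
  refine Finset.sum_congr rfl fun i _ => ?_
  rw [expectation_eq_ofReal_re hX (hA.1 i), expectation_eq_ofReal_re hY (hA.1 i),
    ← Complex.ofReal_mul]
  simp

open scoped MatrixOrder in
/-- The purity of a density matrix is at most one: `O = Kᴴ * K` is a Gram matrix, and by
Cauchy–Schwarz `‖O i j‖ ^ 2 ≤ O i i * O j j`. -/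
theorem IsDensityMatrix.trace_mul_self_re_le {n : Type*} [Fintype n] [DecidableEq n]
    {O : Matrix n n ℂ} (hO : IsDensityMatrix O) : (O * O).trace.re ≤ 1 := by
  obtain ⟨K, hK⟩ : ∃ K : Matrix n n ℂ, O = K.conjTranspose * K :=
    CStarAlgebra.nonneg_iff_eq_star_mul_self.1 hO.1.nonneg
  have hdiag : ∀ i, (O i i).re = ∑ k, ‖K k i‖ ^ 2 := by
    intro i
    rw [hK, Matrix.mul_apply, Complex.re_sum]
    refine Finset.sum_congr rfl fun k _ => ?_
    rw [Matrix.conjTranspose_apply, ← Complex.normSq_eq_norm_sq, Complex.star_def,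
      ← Complex.normSq_eq_conj_mul_self, Complex.ofReal_re]
  have hoff : ∀ i j, ‖O i j‖ ^ 2 ≤ (O i i).re * (O j j).re := by
    intro i j
    have h1 : ‖O i j‖ ≤ ∑ k, ‖K k i‖ * ‖K k j‖ := by
      rw [hK, Matrix.mul_apply]
      refine (norm_sum_le _ _).trans_eq (Finset.sum_congr rfl fun k _ => ?_)
      rw [norm_mul, Matrix.conjTranspose_apply, norm_star]
    rw [hdiag, hdiag]
    exact (pow_le_pow_left₀ (norm_nonneg _) h1 2).trans (Finset.sum_mul_sq_le_sq_mul_sq _ _ _)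
  have htr : ∑ i, (O i i).re = 1 := by
    rw [← Complex.re_sum]
    exact (congrArg Complex.re hO.2).trans Complex.one_re
  calc (O * O).trace.re = ∑ i, ∑ j, ‖O i j‖ ^ 2 := by
        simp only [Matrix.trace, Matrix.diag_apply, Matrix.mul_apply, Complex.re_sum]
        refine Finset.sum_congr rfl fun i _ => Finset.sum_congr rfl fun j _ => ?_
        rw [← hO.1.1.apply j i, Complex.star_def, Complex.mul_conj, Complex.ofReal_re,
          Complex.normSq_eq_norm_sq]
    _ ≤ ∑ i, ∑ j, (O i i).re * (O j j).re :=
        Finset.sum_le_sum fun i _ => Finset.sum_le_sum fun j _ => hoff i j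
    _ = 1 := by rw [← Finset.sum_mul_sum, htr, one_mul]

theorem expectation_sum_smul_kronecker {dA dB N : ℕ} (p : Fin N → ℝ)
    (O : Fin N → Matrix (Fin dA) (Fin dA) ℂ) (Q : Fin N → Matrix (Fin dB) (Fin dB) ℂ)
    (X : Matrix (Fin dA) (Fin dA) ℂ) (Y : Matrix (Fin dB) (Fin dB) ℂ) :
    expectation (∑ k, (p k : ℂ) • (O k ⊗ₖ Q k)) (X ⊗ₖ Y) =
      ∑ k, (p k : ℂ) * (expectation (O k) X * expectation (Q k) Y) := by
  simp [expectation, Matrix.sum_mul, Matrix.trace_sum, ← Matrix.mul_kronecker_mul,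
    Matrix.trace_kronecker]

/-- If the mixture `∑ k, p k • O k` of density matrices annihilates the traceless
observables, then its coordinates are those of the maximally mixed state. -/
theorem sum_smul_observableCoords_eq {n N : ℕ} (hn : 0 < n)
    {A : Fin (n ^ 2) → Matrix (Fin n) (Fin n) ℂ} (hA : IsObservableBasis A) {p : Fin N → ℝ}
    (hp : ∑ k, p k = 1) {O : Fin N → Matrix (Fin n) (Fin n) ℂ} (hO : ∀ k, IsDensityMatrix (O k))
    (h0 : ∀ X : Matrix (Fin n) (Fin n) ℂ, X.IsHermitian → X.trace = 0 →
      ∑ k, (p k : ℂ) * expectation (O k) X = 0) (i : Fin (n ^ 2)) :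
    ∑ k, p k * observableCoords A (O k) i = observableCoords A 1 i / n := by
  have hn' : (n : ℂ) ≠ 0 := by exact_mod_cast hn.ne'
  have htr : (A i).trace = ((observableCoords A 1 i : ℝ) : ℂ) := by
    have := expectation_eq_ofReal_re (Matrix.isHermitian_one (n := Fin n) (α := ℂ)) (hA.1 i)
    rw [expectation, Matrix.one_mul] at this
    rw [this]
    simp [observableCoords, expectation]
  set c : ℝ := observableCoords A 1 i / n
  have h1 := h0 (A i - (c : ℂ) • 1) (isHermitian_sub_smul_one (hA.1 i) c) (by
      rw [Matrix.trace_sub, Matrix.trace_smul, Matrix.trace_one, htr, Fintype.card_fin, smul_eq_mul]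
      simp only [c, Complex.ofReal_div, Complex.ofReal_natCast]
      field_simp
      ring)
  have h2 : ∀ k, expectation (O k) (A i - (c : ℂ) • 1) =
      ((observableCoords A (O k) i - c : ℝ) : ℂ) := by
    intro k
    have := expectation_eq_ofReal_re (hO k).1.1 (hA.1 i)
    rw [expectation, Matrix.mul_sub, Matrix.trace_sub, Matrix.mul_smul, Matrix.mul_one,
      Matrix.trace_smul, (hO k).2]
    change expectation (O k) (A i) - _ = _
    rw [this]
    simp [observableCoords]
  simp only [h2] at h1
  have h3 : ∑ k, p k * (observableCoords A (O k) i - c) = 0 := by exact_mod_cast h1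
  simp only [mul_sub, Finset.sum_sub_distrib, ← Finset.sum_mul, hp, one_mul] at h3
  linarith

theorem observableCoords_sub_smul_one {n : ℕ} (A : Fin (n ^ 2) → Matrix (Fin n) (Fin n) ℂ)
    (O : Matrix (Fin n) (Fin n) ℂ) (c : ℝ) (i : Fin (n ^ 2)) :
    observableCoords A (O - (c : ℂ) • 1) i = observableCoords A O i - c * observableCoords A 1 i := by
  simp [observableCoords, expectation, Matrix.sub_mul, Matrix.trace_sub]

/-- The traceless part of a density matrix is orthogonal to the identity. -/
theorem IsObservableBasis.inner_one_traceless {n : ℕ} (hn : 0 < n)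
    {A : Fin (n ^ 2) → Matrix (Fin n) (Fin n) ℂ} (hA : IsObservableBasis A)
    {O : Matrix (Fin n) (Fin n) ℂ} (hO : IsDensityMatrix O) :
    inner ℝ (observableCoords A 1)
      (observableCoords A (O - (((n : ℝ)⁻¹ : ℝ) : ℂ) • 1)) = 0 := by
  have hn' : (n : ℂ) ≠ 0 := by exact_mod_cast hn.ne'
  rw [hA.inner_observableCoords Matrix.isHermitian_one (isHermitian_sub_smul_one hO.1.1 _),
    Matrix.one_mul, Matrix.trace_sub, hO.2, Matrix.trace_smul, Matrix.trace_one]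
  simp [hn']

/-- The traceless part of a density matrix has squared norm `tr O² - 1 / n ≤ 1 - 1 / n`. -/
theorem IsObservableBasis.norm_traceless_le {n : ℕ} (hn : 0 < n)
    {A : Fin (n ^ 2) → Matrix (Fin n) (Fin n) ℂ} (hA : IsObservableBasis A)
    {O : Matrix (Fin n) (Fin n) ℂ} (hO : IsDensityMatrix O) :
    ‖observableCoords A (O - (((n : ℝ)⁻¹ : ℝ) : ℂ) • 1)‖ ≤ √(1 - (n : ℝ)⁻¹) := by
  have hn' : (n : ℂ) ≠ 0 := by exact_mod_cast hn.ne'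
  have hH := isHermitian_sub_smul_one hO.1.1 (n : ℝ)⁻¹
  refine Real.le_sqrt_of_sq_le ?_
  rw [← real_inner_self_eq_norm_sq, hA.inner_observableCoords hH hH]
  have h1 : ((O - (((n : ℝ)⁻¹ : ℝ) : ℂ) • 1) * (O - (((n : ℝ)⁻¹ : ℝ) : ℂ) • 1)).trace =
      (O * O).trace - (((n : ℝ)⁻¹ : ℝ) : ℂ) := by
    simp only [Matrix.sub_mul, Matrix.mul_sub, Matrix.trace_sub, Matrix.smul_mul, Matrix.mul_smul,
      Matrix.one_mul, Matrix.mul_one, Matrix.trace_smul, hO.2, Matrix.trace_one, smul_eq_mul]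
    push_cast
    simp only [Fintype.card_fin]
    field_simp
    ring
  rw [h1, Complex.sub_re, Complex.ofReal_re]
  linarith [hO.trace_mul_self_re_le]

theorem IsObservableBasis.norm_observableCoords_one {n : ℕ} (hn : 0 < n)
    {A : Fin (n ^ 2) → Matrix (Fin n) (Fin n) ℂ} (hA : IsObservableBasis A) :
    ‖(√(n : ℝ))⁻¹ • observableCoords A 1‖ = 1 := by
  have h1 : ‖observableCoords A 1‖ = √(n : ℝ) := by
    rw [norm_eq_sqrt_real_inner,
      hA.inner_observableCoords Matrix.isHermitian_one Matrix.isHermitian_one]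
    simp
  have : (0 : ℝ) < √(n : ℝ) := Real.sqrt_pos.2 (by exact_mod_cast hn)
  rw [norm_smul, h1, norm_inv, Real.norm_of_nonneg this.le, inv_mul_cancel₀ this.ne']

/-! ### Separable states in Filter Normal Form -/

theorem theorem1 (dA dB d D h : ℕ) (hd : d = min dA dB) (hD : D = max dA dB)
    (hDd : D ≤ d ^ 3) (hh : 1 < h)
    (A : Fin (dA ^ 2) → Matrix (Fin dA) (Fin dA) ℂ) (hA : IsObservableBasis A)
    (B : Fin (dB ^ 2) → Matrix (Fin dB) (Fin dB) ℂ) (hB : IsObservableBasis B)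
    (ρ : Matrix (Fin dA × Fin dB) (Fin dA × Fin dB) ℂ)
    (hsep : IsSeparableState ρ) (hfnf : IsFilterNormalForm ρ)
    (α β : ℝ) (hα : α = 1 / Real.sqrt ((D : ℝ) * d))
    (hβ : β = Real.sqrt (((D : ℝ) - 1) / (D * ((d : ℝ) ^ 2 - 1)) *
      (((d : ℝ) - 1) / (d * ((d : ℝ) ^ 2 - 1))))) :
    correlationMinorNorm h 1 (correlationMatrix A B ρ) ≤
      (α ::ₘ Multiset.replicate (d ^ 2 - 1) β).esymm h := by
  obtain ⟨N, p, O, Q, hp, hp1, hO, hQ, rfl⟩ := hsep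
  -- Some product state occurs, so both local dimensions are positive.
  obtain ⟨k₀⟩ : Nonempty (Fin N) := by
    by_contra hne
    rw [not_nonempty_iff] at hne
    simp at hp1
  have hdA : 0 < dA := by
    rcases Nat.eq_zero_or_pos dA with rfl | h0
    · simpa [Matrix.trace] using (hO k₀).2
    · exact h0
  have hdB : 0 < dB := by
    rcases Nat.eq_zero_or_pos dB with rfl | h0
    · simpa [Matrix.trace] using (hQ k₀).2
    · exact h0
  have hd1 : 1 ≤ d := by omega
  have hdA' : (0 : ℝ) < dA := by exact_mod_cast hdA
  have hdB' : (0 : ℝ) < dB := by exact_mod_cast hdB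
  set w := observableCoords A 1 with hw
  set z := observableCoords B 1 with hz
  have hmeanA := sum_smul_observableCoords_eq hdA hA hp1 hO fun X hX hX0 => by
    rw [← hfnf.1 X hX hX0, expectation_sum_smul_kronecker]
    exact Finset.sum_congr rfl fun k _ => by simp [expectation, (hQ k).2]
  have hmeanB := sum_smul_observableCoords_eq hdB hB hp1 hQ fun Y hY hY0 => by
    rw [← hfnf.2 Y hY hY0, expectation_sum_smul_kronecker]
    exact Finset.sum_congr rfl fun k _ => by simp [expectation, (hO k).2]
  have hC : ∀ i j, correlationMatrix A B (∑ k, (p k : ℂ) • (O k ⊗ₖ Q k)) i j =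
      ∑ k, p k * (observableCoords A (O k) i * observableCoords B (Q k) j) := by
    intro i j
    rw [correlationMatrix, Matrix.of_apply, expectation_sum_smul_kronecker, Complex.re_sum]
    refine Finset.sum_congr rfl fun k _ => ?_
    rw [expectation_eq_ofReal_re (hO k).1.1 (hA.1 i), expectation_eq_ofReal_re (hQ k).1.1 (hB.1 j),
      ← Complex.ofReal_mul, ← Complex.ofReal_mul, Complex.ofReal_re]
    rfl
  have hprod : (D : ℝ) * d = dA * dB := by
    rw [hD, hd]
    exact_mod_cast max_mul_min dA dB
  have hα' : α = (√(dA : ℝ))⁻¹ * (√(dB : ℝ))⁻¹ := by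
    rw [hα, hprod, Real.sqrt_mul hdA'.le, one_div, mul_inv]
  refine correlationMinorNorm_one_le_of_orthogonal (ι := Fin N) h (by rw [hα]; positivity) ?_
    (hA.norm_observableCoords_one hdA) (hB.norm_observableCoords_one hdB)
    (a := fun k => p k • observableCoords A (O k - (((dA : ℝ)⁻¹ : ℝ) : ℂ) • 1))
    (b := fun k => observableCoords B (Q k - (((dB : ℝ)⁻¹ : ℝ) : ℂ) • 1)) ?_ ?_ ?_ ?_
  · have : min (dA ^ 2) (dB ^ 2) = d ^ 2 := by
      rw [hd]
      exact ((pow_left_mono 2).map_min).symm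
    omega
  · intro k
    rw [inner_smul_left, inner_smul_right, hA.inner_one_traceless hdA (hO k)]
    simp
  · intro k
    rw [inner_smul_left, hB.inner_one_traceless hdB (hQ k), mul_zero]
  · intro i j
    have hsA : (√(dA : ℝ))⁻¹ * (√(dA : ℝ))⁻¹ = (dA : ℝ)⁻¹ := by
      rw [← mul_inv, Real.mul_self_sqrt hdA'.le]
    have hsB : (√(dB : ℝ))⁻¹ * (√(dB : ℝ))⁻¹ = (dB : ℝ)⁻¹ := by
      rw [← mul_inv, Real.mul_self_sqrt hdB'.le]
    -- The marginals turn the three correction terms into one multiple of `w i * z j`.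
    have hcross : ∑ k, p k * ((observableCoords A (O k) i - (dA : ℝ)⁻¹ * w i) *
        (observableCoords B (Q k) j - (dB : ℝ)⁻¹ * z j)) =
        ∑ k, p k * (observableCoords A (O k) i * observableCoords B (Q k) j) -
        (dB : ℝ)⁻¹ * z j * ∑ k, p k * observableCoords A (O k) i -
        (dA : ℝ)⁻¹ * w i * ∑ k, p k * observableCoords B (Q k) j +
        (dA : ℝ)⁻¹ * w i * ((dB : ℝ)⁻¹ * z j) * ∑ k, p k := by
      simp only [Finset.mul_sum, ← Finset.sum_sub_distrib, ← Finset.sum_add_distrib]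
      exact Finset.sum_congr rfl fun _ _ => by ring
    simp only [WithLp.ofLp_smul, Pi.smul_apply, smul_eq_mul, observableCoords_sub_smul_one,
      mul_assoc]
    rw [hcross, hC, hmeanA, hmeanB, hp1, hα', ← hw, ← hz]
    linear_combination (-(dB : ℝ)⁻¹ * w i * z j) * hsA -
      (√(dA : ℝ))⁻¹ * (√(dA : ℝ))⁻¹ * w i * z j * hsB
  · have hbound : ∀ k, ‖p k • observableCoords A (O k - (((dA : ℝ)⁻¹ : ℝ) : ℂ) • 1)‖ *
        ‖observableCoords B (Q k - (((dB : ℝ)⁻¹ : ℝ) : ℂ) • 1)‖ ≤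
        p k * (√(1 - (dA : ℝ)⁻¹) * √(1 - (dB : ℝ)⁻¹)) := by
      intro k
      rw [norm_smul, Real.norm_of_nonneg (hp k), mul_assoc]
      exact mul_le_mul_of_nonneg_left (mul_le_mul (hA.norm_traceless_le hdA (hO k))
        (hB.norm_traceless_le hdB (hQ k)) (norm_nonneg _) (Real.sqrt_nonneg _)) (hp k)
    refine (Finset.sum_le_sum fun k _ => hbound k).trans ?_
    have hA1 : 0 ≤ 1 - (dA : ℝ)⁻¹ := sub_nonneg.2 (inv_le_one_of_one_le₀ (by exact_mod_cast hdA))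
    rw [← Finset.sum_mul, hp1, one_mul, ← Real.sqrt_mul hA1]
    have hswap : (1 - (dA : ℝ)⁻¹) * (1 - (dB : ℝ)⁻¹) = (1 - (D : ℝ)⁻¹) * (1 - (d : ℝ)⁻¹) := by
      rcases le_total dA dB with hle | hle
      · rw [hD, hd, max_eq_right hle, min_eq_left hle, mul_comm]
      · rw [hD, hd, max_eq_left hle, min_eq_right hle]
    rw [hswap]
    -- For `d = 1` both sides vanish, although `β` is then a junk quotient.
    rcases hd1.eq_or_lt with rfl | hd2
    · simp
    · have hd2' : (1 : ℝ) < d := by exact_mod_cast hd2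
      have hD2' : (0 : ℝ) < D := by
        have : 0 < D := by omega
        exact_mod_cast this
      have hn : (0 : ℝ) < (d : ℝ) ^ 2 - 1 := by nlinarith
      have hcast : ((d ^ 2 - 1 : ℕ) : ℝ) = (d : ℝ) ^ 2 - 1 := by
        rw [Nat.cast_sub (Nat.one_le_pow _ _ hd1)]
        simp
      rw [hcast, hβ, ← Real.sqrt_sq hn.le, ← Real.sqrt_mul (sq_nonneg _), Real.sqrt_sq hn.le]
      refine (congrArg Real.sqrt ?_).le
      field_simp
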